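/- Let $X \neq \{0\}$ be a real Banach space, let $g : X \to X$ be a surjective isometry whose linear part $\hat g(x) = g(x) - g(0)$ is periodic, i.e. $\hat g^{\,p} = \mathrm{id}_X$ for some integer $p \ge 1$, and put $x_* = g^{-1}(0)$. For $t \in [0,\infty)$ let $F_t = \{f_{(1,t)}, \dots, f_{(N,t)}\}$ be a finite family of maps $X \to X$, let $g_t(x) = t\,g(x) + x_*$, and let $F_t^g = F_t \cup \{g_t\}$. Assume that (i) for every $i$ and every $x \in X$ the map $[0,1] \ni t \mapsto f_{(i,t)}(x)$ is continuous, and (ii) $\sup\{\mathrm{Lip}(F_t) : t \in [0,1]\} < 1$, where $\mathrm{Lip}(F_t) = \max_i \mathrm{Lip}(f_{(i,t)})$ is taken with respect to the norm. (Nothing is assumed about $f_{(i,t)}$ for $t > 1$.) For a family $F$ of self-maps of $X$ write $F(S) = \bigcup_{\varphi \in F} \varphi(S)$ for $S \subseteq X$. A nonempty compact set $A$ is called an attractor of $F$ if $F(A) = A$ and there is an open set $U \supseteq A$ such that $F^{(n)}(K) \to A$ in the Hausdorff metric for every nonempty compact $K \subseteq U$. Then: (a) $t_0 = 1$ is a threshold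 for $F_t^g$: the family $F_t^g$ has an attractor for every $t \in [0,1)$ and has no attractor for any $t > 1$. Moreover, for $t \in [0,1)$ the attractor of $F_t^g$ is unique; denote it by $A_t$. (b) $F_t^g$ has a unique upper transition attractor, i.e. there is exactly one nonempty compact set $A^\bullet$ such that $A^\bullet = \lim_{n} A_{t_n}$ in the Hausdorff metric for some increasing sequence $t_n \to 1$ in $[0,1)$. Moreover, the full limit $\lim_{t \to 1^-} A_t$ exists in the Hausdorff metric and equals $A^\bullet$, and $F_1^g(A^\bullet) = A^\bullet$. -/

import Mathlib

open Filter Topology Set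
open scoped ENNReal
open TopologicalSpace (NonemptyCompacts)

noncomputable section

namespace IFS

/-- The Lipschitz constant `sup_{x ≠ y} d(φ x, φ y) / d(x, y)` of a self-map, as an element of
`[0, ∞]`. -/
def lip {X : Type*} [MetricSpace X] (φ : X → X) : ℝ≥0∞ :=
  ⨆ (x : X) (y : X) (_ : x ≠ y), edist (φ x) (φ y) / edist x y

/-- The Lipschitz constant of an iterated function system (a set of self-maps). -/
def lipSystem {X : Type*} [MetricSpace X] (F : Set (X → X)) : ℝ≥0∞ :=
  ⨆ φ ∈ F, lip φ

/-- The Hutchinson operator `S ↦ ⋃_{φ ∈ F} φ(S)`. -/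
def hutchinson {X : Type*} (F : Set (X → X)) (S : Set X) : Set X :=
  ⋃ φ ∈ F, φ '' S

/-- The nonempty compact set `A` is a (strict) attractor of `F`: it is `F`-invariant and has an
open neighbourhood `U` such that the Hutchinson iterates of every nonempty compact `K ⊆ U`
converge to `A` in the Hausdorff metric. -/
def IsAttractor {X : Type*} [MetricSpace X] (F : Set (X → X)) (A : NonemptyCompacts X) : Prop :=
  ∃ U : Set X, IsOpen U ∧ (A : Set X) ⊆ U ∧ hutchinson F (A : Set X) = A ∧
    ∀ K : Set X, K.Nonempty → IsCompact K → K ⊆ U →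
      Tendsto (fun n : ℕ => Metric.hausdorffEDist ((hutchinson F)^[n] K) (A : Set X))
        atTop (𝓝 0)

/-- `t₀` is the threshold for the existence of an attractor of the one-parameter family
`F t`, `t ∈ [0, ∞)`. -/
def IsThreshold {X : Type*} [MetricSpace X] (F : ℝ → Set (X → X)) (t₀ : ℝ) : Prop :=
  (∀ t : ℝ, 0 ≤ t → t < t₀ → ∃ A : NonemptyCompacts X, IsAttractor (F t) A) ∧
  (∀ t : ℝ, 0 ≤ t → t₀ < t → ¬ ∃ A : NonemptyCompacts X, IsAttractor (F t) A)

/-- `A` is an upper transition attractor (at `t = 1`) of the family `F t`: it is the limit, in the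
Hausdorff metric on nonempty compact sets, of attractors of `F (t n)` for some increasing
sequence `t n → 1` in `[0, 1)`. -/
def IsUpperTransitionAttractor {X : Type*} [MetricSpace X] (F : ℝ → Set (X → X))
    (A : NonemptyCompacts X) : Prop :=
  ∃ (t : ℕ → ℝ) (B : ℕ → NonemptyCompacts X),
    StrictMono t ∧ (∀ n, t n ∈ Ico (0 : ℝ) 1) ∧ Tendsto t atTop (𝓝 1) ∧
    (∀ n, IsAttractor (F (t n)) (B n)) ∧ Tendsto B atTop (𝓝 A)

/-- The system `F_t = {f_{(i,t)} : 1 ≤ i ≤ N}`. -/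
def family {X : Type*} {N : ℕ} (f : Fin N → ℝ → X → X) (t : ℝ) : Set (X → X) :=
  range fun i => f i t

/-- The map `g_t(x) = t g(x) + x_*`, where `x_* = g⁻¹(0)`. -/
def scaled {X : Type*} [NormedAddCommGroup X] [NormedSpace ℝ X] (g : X ≃ᵢ X) (t : ℝ) : X → X :=
  fun x => t • g x + g.symm 0

/-- The system `F_t^g = F_t ∪ {g_t}`. -/
def extendedFamily {X : Type*} [NormedAddCommGroup X] [NormedSpace ℝ X] {N : ℕ}
    (f : Fin N → ℝ → X → X) (g : X ≃ᵢ X) (t : ℝ) : Set (X → X) :=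
  family f t ∪ {scaled g t}

/-- The linear part `x ↦ g x - g 0` of the surjective isometry `g` (linear by the Mazur-Ulam
theorem) is periodic: some positive iterate of it is the identity. -/
def HasPeriodicLinearPart {X : Type*} [NormedAddCommGroup X] [NormedSpace ℝ X]
    (g : X ≃ᵢ X) : Prop :=
  ∃ p : ℕ, 0 < p ∧ ∀ x : X, (g.toRealLinearIsometryEquiv)^[p] x = x

end IFS

end

/-!
Let `z = g⁻¹ 0` and let `L` be the linear part of `g`, so that `scaled g t` is the affine map with
fixed point `z` and linear part `t L`. For a compact set `Q` of operators of norm at most one, the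
maps `x ↦ z + M (φ x - z)`, with `M ∈ Q` and `φ` in the given system, inherit the contraction ratio
of that system. If moreover `Q = {1} ∪ t L Q`, then a set invariant under them and the constant `z`
is invariant under the given system together with `scaled g t`. For `t < 1` one can take for `Q` the
set of powers of `t L` together with `0`; for `t = 1`, thanks to the finite order of `L`, the
multiples `s L ^ k` with `s ∈ [0, 1]`. The former set is `(1 - t ^ p)`-dense in the latter, where
`p` is the order of `L`. So the invariant sets converge as `t → 1⁻`, although the contraction ratio
of `scaled g t` degenerates there. For `t > 1` the map `scaled g t` is expanding, and the iterates
of two distinct points drift apart.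
-/

open scoped NNReal Pointwise

namespace IFS

section Hutchinson

variable {X : Type*} {F : Set (X → X)} {S : Set X}

theorem mem_hutchinson {y : X} : y ∈ hutchinson F S ↔ ∃ φ ∈ F, ∃ x ∈ S, φ x = y := by
  simp only [hutchinson, mem_iUnion₂, mem_image, exists_prop]

theorem hutchinson_insert (φ : X → X) (F : Set (X → X)) (S : Set X) :
    hutchinson (insert φ F) S = φ '' S ∪ hutchinson F S :=
  biUnion_insert φ F fun ψ => ψ '' S

theorem iterate_mem_iterate_hutchinson {φ : X → X} (hφ : φ ∈ F) {x : X} (hx : x ∈ S) (n : ℕ) :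
    φ^[n] x ∈ (hutchinson F)^[n] S := by
  induction n with
  | zero => exact hx
  | succ n ih =>
    rw [Function.iterate_succ_apply', Function.iterate_succ_apply']
    exact mem_hutchinson.2 ⟨φ, hφ, _, ih, rfl⟩

end Hutchinson

section Lipschitz

variable {X : Type*} [MetricSpace X] {F G : Set (X → X)} {K : ℝ≥0}

theorem lipschitzWith_of_lip_le {φ : X → X} (h : lip φ ≤ K) : LipschitzWith K φ := by
  intro x y
  rcases eq_or_ne x y with rfl | hxy
  · simp
  · have hquot : edist (φ x) (φ y) / edist x y ≤ K :=
      (le_iSup₂_of_le x y (le_iSup (fun _ : x ≠ y => edist (φ x) (φ y) / edist x y) hxy)).trans h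
    exact (ENNReal.div_le_iff (edist_pos.2 hxy).ne' (edist_ne_top x y)).1 hquot

theorem isCompact_hutchinson (hF : IsCompact F) (hK : ∀ φ ∈ F, LipschitzWith K φ) {S : Set X}
    (hS : IsCompact S) : IsCompact (hutchinson F S) := by
  have heval : ContinuousOn (fun q : (X → X) × X => q.1 q.2) (F ×ˢ S) :=
    continuousOn_prod_of_continuousOn_lipschitzOnWith' _ K
      (fun φ hφ => (hK φ hφ).lipschitzOnWith) fun x _ => (continuous_apply x).continuousOn
  have himage : (fun q : (X → X) × X => q.1 q.2) '' (F ×ˢ S) = hutchinson F S := by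
    ext y
    simp only [mem_hutchinson, mem_image, mem_prod, Prod.exists, and_assoc, exists_and_left]
  exact himage ▸ (hF.prod hS).image_of_continuousOn heval

theorem hausdorffEDist_hutchinson_le (hK : ∀ φ ∈ F, LipschitzWith K φ) (A B : NonemptyCompacts X) :
    Metric.hausdorffEDist (hutchinson F (A : Set X)) (hutchinson F B) ≤ K * edist A B := by
  have hone : ∀ A B : NonemptyCompacts X, ∀ y ∈ hutchinson F (A : Set X),
      ∃ y' ∈ hutchinson F (B : Set X), edist y y' ≤ K * edist A B := by
    intro A B y hy
    obtain ⟨φ, hφ, a, ha, rfl⟩ := mem_hutchinson.1 hy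
    obtain ⟨b, hb, hab⟩ := B.isCompact.exists_infEDist_eq_edist B.nonempty a
    refine ⟨φ b, mem_hutchinson.2 ⟨φ, hφ, b, hb, rfl⟩, (hK φ hφ a b).trans ?_⟩
    gcongr
    exact hab ▸ Metric.infEDist_le_hausdorffEDist_of_mem ha
  exact Metric.hausdorffEDist_le_of_mem_edist (hone A B) (edist_comm A B ▸ hone B A)

theorem hausdorffDist_hutchinson_le {S : Set X} {r : ℝ} (hr : 0 ≤ r)
    (hFG : ∀ φ ∈ F, ∃ ψ ∈ G, ∀ x ∈ S, dist (φ x) (ψ x) ≤ r)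
    (hGF : ∀ ψ ∈ G, ∃ φ ∈ F, ∀ x ∈ S, dist (ψ x) (φ x) ≤ r) :
    Metric.hausdorffDist (hutchinson F S) (hutchinson G S) ≤ r := by
  have hone : ∀ {F G : Set (X → X)}, (∀ φ ∈ F, ∃ ψ ∈ G, ∀ x ∈ S, dist (φ x) (ψ x) ≤ r) →
      ∀ y ∈ hutchinson F S, ∃ y' ∈ hutchinson G S, dist y y' ≤ r := by
    intro F G h y hy
    obtain ⟨φ, hφ, x, hx, rfl⟩ := mem_hutchinson.1 hy
    obtain ⟨ψ, hψ, hdist⟩ := h φ hφ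
    exact ⟨ψ x, mem_hutchinson.2 ⟨ψ, hψ, x, hx, rfl⟩, hdist x hx⟩
  exact Metric.hausdorffDist_le_of_mem_dist hr (hone hFG) (hone hGF)

/-- A system of maps that is compact for the topology of pointwise convergence and consists of
contractions with a common ratio `K < 1`. Finite systems of contractions are the classical case;
infinite ones occur as a `coneSystem`. -/
structure IsContractive (K : ℝ≥0) (F : Set (X → X)) : Prop where
  lt_one : K < 1
  isCompact : IsCompact F
  lipschitzWith : ∀ φ ∈ F, LipschitzWith K φ

namespace IsContractive

theorem insert (hF : IsContractive K F) {φ : X → X} {K' : ℝ≥0} (hK' : K' < 1)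
    (hφ : LipschitzWith K' φ) : IsContractive (max K K') (insert φ F) where
  lt_one := max_lt hF.lt_one hK'
  isCompact := hF.isCompact.insert φ
  lipschitzWith := forall_mem_insert.2 ⟨hφ.weaken (le_max_right K K'),
    fun ψ hψ => (hF.lipschitzWith ψ hψ).weaken (le_max_left K K')⟩

/-- The Hutchinson operator of a nonempty contractive system, as a self-map of the space of
nonempty compact sets. -/
def operator (hF : IsContractive K F) (hne : F.Nonempty) (S : NonemptyCompacts X) :
    NonemptyCompacts X where
  carrier := hutchinson F S
  isCompact' := isCompact_hutchinson hF.isCompact hF.lipschitzWith S.isCompact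
  nonempty' := nonempty_biUnion.2 (hne.imp fun φ hφ => ⟨hφ, S.nonempty.image φ⟩)

theorem contractingWith_operator (hF : IsContractive K F) (hne : F.Nonempty) :
    ContractingWith K (hF.operator hne) :=
  ⟨hF.lt_one, hausdorffEDist_hutchinson_le hF.lipschitzWith⟩

theorem coe_iterate_operator (hF : IsContractive K F) (hne : F.Nonempty) (S : NonemptyCompacts X)
    (n : ℕ) : ((hF.operator hne)^[n] S : Set X) = (hutchinson F)^[n] S :=
  Function.Semiconj.iterate_right (f := ((↑) : NonemptyCompacts X → Set X)) (fun _ => rfl) n S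

theorem exists_hutchinson_eq [CompleteSpace X] [Nonempty X] (hF : IsContractive K F)
    (hne : F.Nonempty) : ∃ A : NonemptyCompacts X, hutchinson F (A : Set X) = A :=
  ⟨_, congrArg ((↑) : NonemptyCompacts X → Set X)
    (hF.contractingWith_operator hne).fixedPoint_isFixedPt⟩

theorem dist_le_of_hutchinson_eq (hF : IsContractive K F) (hne : F.Nonempty)
    (A : NonemptyCompacts X) {B : NonemptyCompacts X} (hB : hutchinson F (B : Set X) = B) :
    dist A B ≤ Metric.hausdorffDist (A : Set X) (hutchinson F A) / (1 - K) :=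
  (hF.contractingWith_operator hne).dist_le_of_fixedPoint A (NonemptyCompacts.ext hB)

theorem isAttractor_iff_eq [CompleteSpace X] (hF : IsContractive K F) (hne : F.Nonempty)
    {A : NonemptyCompacts X} (hA : hutchinson F (A : Set X) = A) (B : NonemptyCompacts X) :
    IsAttractor F B ↔ B = A := by
  have hT := hF.contractingWith_operator hne
  have hAfix : Function.IsFixedPt (hF.operator hne) A := NonemptyCompacts.ext hA
  constructor
  · rintro ⟨U, -, -, hB, -⟩
    exact hT.fixedPoint_unique' (NonemptyCompacts.ext hB) hAfix
  · rintro rfl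
    refine ⟨univ, isOpen_univ, subset_univ _, hA, fun S hS hSc _ => ?_⟩
    have : Nonempty (NonemptyCompacts X) := ⟨B⟩
    have hlim := hT.tendsto_iterate_fixedPoint ⟨⟨S, hSc⟩, hS⟩
    rw [← hT.fixedPoint_unique hAfix, tendsto_iff_edist_tendsto_0] at hlim
    refine hlim.congr fun n => ?_
    exact congrArg (Metric.hausdorffEDist · (B : Set X)) (hF.coe_iterate_operator hne _ n)

end IsContractive

theorem exists_forall_isContractive_family {N : ℕ} {f : Fin N → ℝ → X → X} {s : Set ℝ}
    (hlip : ⨆ t ∈ s, lipSystem (family f t) < 1) :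
    ∃ K : ℝ≥0, ∀ t ∈ s, IsContractive K (family f t) := by
  obtain ⟨K, hK, hK1⟩ := ENNReal.lt_iff_exists_nnreal_btwn.1 hlip
  refine ⟨K, fun t ht => ⟨mod_cast hK1, (finite_range _).isCompact, fun φ hφ => ?_⟩⟩
  exact lipschitzWith_of_lip_le
    ((le_iSup₂_of_le t ht (le_iSup₂ (f := fun φ _ => lip φ) φ hφ)).trans hK.le)

theorem tendstoUniformlyOn_of_lipschitzWith {T Y : Type*} [TopologicalSpace T] [MetricSpace Y]
    {f : T → X → Y} {s : Set T} {t₀ : T} (ht₀ : t₀ ∈ s)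
    (hcont : ∀ x, ContinuousOn (fun t => f t x) s) (hf : ∀ t ∈ s, LipschitzWith K (f t))
    {A : Set X} (hA : IsCompact A) : TendstoUniformlyOn f (f t₀) (𝓝[s] t₀) A := by
  have hjoint : ContinuousOn (Function.uncurry f) (s ×ˢ A) :=
    continuousOn_prod_of_continuousOn_lipschitzOnWith' _ K
      (fun t ht => (hf t ht).lipschitzOnWith) fun x _ => hcont x
  refine Metric.tendstoUniformlyOn_iff.2 fun ε hε => ?_
  obtain ⟨v, hv, hdist⟩ := hA.mem_uniformity_of_prod hjoint ht₀ (Metric.dist_mem_uniformity hε)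
  filter_upwards [hv] with t ht x hx
  exact dist_comm (f t x) (f t₀ x) ▸ hdist t ht x hx

end Lipschitz

section Expanding

variable {X : Type*} [MetricSpace X] {F : Set (X → X)} {φ : X → X} {K : ℝ≥0}

theorem antilipschitzWith_iterate (hφ : AntilipschitzWith K φ) (n : ℕ) :
    AntilipschitzWith (K ^ n) φ^[n] := by
  induction n with
  | zero => exact AntilipschitzWith.id
  | succ n ih => exact pow_succ' K n ▸ ih.comp hφ

theorem eq_of_eventually_dist_iterate_le (hφ : AntilipschitzWith K φ) (hK : K < 1) {x y : X}
    {C : ℝ} (h : ∀ᶠ n in atTop, dist (φ^[n] x) (φ^[n] y) ≤ C) : x = y := by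
  have hlim : Tendsto (fun n : ℕ => (K : ℝ) ^ n * C) atTop (𝓝 0) := by
    simpa using (tendsto_pow_atTop_nhds_zero_of_lt_one K.2 hK).mul_const C
  refine dist_le_zero.1 (ge_of_tendsto hlim ?_)
  filter_upwards [h] with n hn
  calc dist x y ≤ (K ^ n : ℝ≥0) * dist (φ^[n] x) (φ^[n] y) :=
        (antilipschitzWith_iterate hφ n).le_mul_dist x y
    _ ≤ K ^ n * C := by push_cast; gcongr

theorem eventually_dist_iterate_le (hφ : φ ∈ F) {S A : Set X} (hA : Bornology.IsBounded A)
    (hlim : Tendsto (fun n : ℕ => Metric.hausdorffEDist ((hutchinson F)^[n] S) A) atTop (𝓝 0))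
    {x y : X} (hx : x ∈ S) (hy : y ∈ S) :
    ∀ᶠ n in atTop, dist (φ^[n] x) (φ^[n] y) ≤ 2 + Metric.diam A := by
  filter_upwards [hlim.eventually_lt_const one_pos] with n hn
  have hnear : ∀ w ∈ S, ∃ a ∈ A, dist (φ^[n] w) a < 1 := by
    intro w hw
    obtain ⟨a, ha, hdist⟩ := Metric.exists_edist_lt_of_hausdorffEDist_lt
      (iterate_mem_iterate_hutchinson hφ hw n) hn
    exact ⟨a, ha, by simpa [edist_dist] using hdist⟩
  obtain ⟨a, ha, hxa⟩ := hnear x hx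
  obtain ⟨b, hb, hyb⟩ := hnear y hy
  linarith [dist_triangle4_right (φ^[n] x) (φ^[n] y) a b, Metric.dist_le_diam_of_mem hA ha hb]

theorem not_isAttractor_of_antilipschitzWith [PerfectSpace X] (hφF : φ ∈ F)
    (hφ : AntilipschitzWith K φ) (hK : K < 1) (A : NonemptyCompacts X) : ¬IsAttractor F A := by
  rintro ⟨U, hU, hAU, -, hlim⟩
  obtain ⟨a, ha⟩ := A.nonempty
  have haU : U ∈ 𝓝[≠] a := nhdsWithin_le_nhds (hU.mem_nhds (hAU ha))
  obtain ⟨x, hxU, hxa⟩ := Filter.nonempty_of_mem (inter_mem haU self_mem_nhdsWithin)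
  have hconv := hlim {x, a} (insert_nonempty x {a}) (toFinite {x, a}).isCompact
    (pair_subset hxU (hAU ha))
  exact hxa (eq_of_eventually_dist_iterate_le hφ hK
    (eventually_dist_iterate_le hφF A.isCompact.isBounded hconv (mem_insert x {a})
      (mem_insert_of_mem x rfl)))

end Expanding

section UpperTransition

theorem isUpperTransitionAttractor_iff_eq {X : Type*} [MetricSpace X] {F : ℝ → Set (X → X)}
    {A : ℝ → NonemptyCompacts X} {A₁ : NonemptyCompacts X}
    (hA : ∀ t ∈ Ico (0 : ℝ) 1, ∀ B, IsAttractor (F t) B ↔ B = A t)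
    (hlim : Tendsto A (𝓝[<] 1) (𝓝 A₁)) (C : NonemptyCompacts X) :
    IsUpperTransitionAttractor F C ↔ C = A₁ := by
  have hlimSeq : ∀ t : ℕ → ℝ, (∀ n, t n ∈ Ico (0 : ℝ) 1) → Tendsto t atTop (𝓝 1) →
      Tendsto (A ∘ t) atTop (𝓝 A₁) := fun t ht hconv =>
    hlim.comp (tendsto_nhdsWithin_iff.2 ⟨hconv, Eventually.of_forall fun n => (ht n).2⟩)
  constructor
  · rintro ⟨t, B, -, ht, hconv, hB, hBC⟩
    obtain rfl : B = A ∘ t := funext fun n => (hA _ (ht n) _).1 (hB n)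
    exact tendsto_nhds_unique hBC (hlimSeq t ht hconv)
  · rintro rfl
    obtain ⟨t, hmono, ht, hconv⟩ := exists_seq_strictMono_tendsto' (zero_lt_one (α := ℝ))
    have ht' : ∀ n, t n ∈ Ico (0 : ℝ) 1 := fun n => Ioo_subset_Ico_self (ht n)
    exact ⟨t, A ∘ t, hmono, ht', hconv, fun n => (hA _ (ht' n) _).2 rfl, hlimSeq t ht' hconv⟩

end UpperTransition

section PowerSets

/-- The powers of `a` together with `0`. For `‖a‖ < 1` this is the closure of the set of powers, and
it is compact. -/
def zeroPowers {E : Type*} [MonoidWithZero E] (a : E) : Set E :=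
  insert 0 (Submonoid.powers a)

/-- The union of the segments that join `0` to the powers of `a`. When `a` has finite order and norm
at most one, it is the limit of `zeroPowers (t • a)` as `t → 1⁻`. -/
def starPowers {E : Type*} [Ring E] [Algebra ℝ E] (a : E) : Set E :=
  Icc (0 : ℝ) 1 • (Submonoid.powers a : Set E)

theorem mem_starPowers {E : Type*} [Ring E] [Algebra ℝ E] {a b : E} :
    b ∈ starPowers a ↔ ∃ s ∈ Icc (0 : ℝ) 1, ∃ n : ℕ, s • a ^ n = b := by
  simp only [starPowers, Set.mem_smul, SetLike.mem_coe, Submonoid.mem_powers_iff,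
    exists_exists_eq_and]

theorem insert_one_image_mul_zeroPowers {E : Type*} [MonoidWithZero E] (a : E) :
    insert 1 ((a * ·) '' zeroPowers a) = zeroPowers a := by
  refine Subset.antisymm (insert_subset (Or.inr (one_mem _)) ?_) ?_
  · rintro _ ⟨_, rfl | ⟨n, rfl⟩, rfl⟩
    · exact Or.inl (mul_zero a)
    · exact Or.inr ⟨n + 1, pow_succ' a n⟩
  · rintro _ (rfl | ⟨_ | n, rfl⟩)
    · exact Or.inr ⟨0, mem_insert 0 _, mul_zero a⟩
    · exact Or.inl (pow_zero a)
    · exact Or.inr ⟨a ^ n, Or.inr ⟨n, rfl⟩, (pow_succ' a n).symm⟩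

theorem insert_one_image_mul_starPowers {E : Type*} [Ring E] [Algebra ℝ E] {a : E}
    (ha : IsOfFinOrder a) : insert 1 ((a * ·) '' starPowers a) = starPowers a := by
  obtain ⟨p, hp⟩ := Nat.exists_eq_add_one.2 ha.orderOf_pos
  refine Subset.antisymm (insert_subset ?_ ?_) fun b hb => Or.inr ?_
  · exact mem_starPowers.2 ⟨1, right_mem_Icc.2 zero_le_one, 0, by simp⟩
  · rintro _ ⟨b, hb, rfl⟩
    obtain ⟨s, hs, n, rfl⟩ := mem_starPowers.1 hb
    exact mem_starPowers.2 ⟨s, hs, n + 1, pow_succ' a n ▸ (mul_smul_comm s a (a ^ n)).symm⟩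
  · obtain ⟨s, hs, n, rfl⟩ := mem_starPowers.1 hb
    refine ⟨s • a ^ (p + n), mem_starPowers.2 ⟨s, hs, p + n, rfl⟩, ?_⟩
    beta_reduce
    rw [mul_smul_comm, ← pow_succ', add_right_comm, ← hp, pow_add, pow_orderOf_eq_one, one_mul]

theorem zeroPowers_smul_subset_starPowers {E : Type*} [Ring E] [Algebra ℝ E] (a : E) {t : ℝ}
    (ht : t ∈ Icc (0 : ℝ) 1) : zeroPowers (t • a) ⊆ starPowers a := by
  rintro _ (rfl | ⟨n, rfl⟩)
  · exact mem_starPowers.2 ⟨0, left_mem_Icc.2 zero_le_one, 0, zero_smul ℝ (a ^ 0)⟩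
  · exact mem_starPowers.2 ⟨t ^ n, ⟨pow_nonneg ht.1 n, pow_le_one₀ ht.1 ht.2⟩, n,
      (smul_pow t a n).symm⟩

theorem isCompact_zeroPowers {E : Type*} [NormedRing E] {a : E} (ha : ‖a‖ < 1) :
    IsCompact (zeroPowers a) :=
  (tendsto_pow_atTop_nhds_zero_of_norm_lt_one ha).isCompact_insert_range

theorem exists_abs_sub_pow_le {s t : ℝ} (hs : s ∈ Ioc (0 : ℝ) 1) (ht : t ∈ Ioo (0 : ℝ) 1)
    {p j : ℕ} (hj : j < p) : ∃ q : ℕ, |s - t ^ (p * q + j)| ≤ 1 - t ^ p := by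
  have hu1 : t ^ p < 1 := pow_lt_one₀ ht.1.le ht.2 hj.ne_bot
  obtain ⟨q, hslow, hsupp⟩ := exists_nat_pow_near_of_lt_one hs.1 hs.2 (pow_pos ht.1 p) hu1
  have hlow : (t ^ p) ^ (q + 1) ≤ t ^ (p * q + j) := by
    rw [← pow_mul]
    exact pow_le_pow_of_le_one ht.1.le ht.2.le (by rw [mul_add_one]; omega)
  have hupp : t ^ (p * q + j) ≤ (t ^ p) ^ q := by
    rw [← pow_mul]
    exact pow_le_pow_of_le_one ht.1.le ht.2.le (by omega)
  refine ⟨q, ?_⟩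
  calc |s - t ^ (p * q + j)| ≤ (t ^ p) ^ q - (t ^ p) ^ (q + 1) :=
        abs_sub_le_of_le_of_le hslow.le hsupp hlow hupp
    _ = (t ^ p) ^ q * (1 - t ^ p) := by rw [pow_succ]; ring
    _ ≤ 1 - t ^ p :=
        mul_le_of_le_one_left (sub_nonneg.2 hu1.le) (pow_le_one₀ (pow_nonneg ht.1.le p) hu1.le)

variable {E : Type*} [NormedRing E] [NormedAlgebra ℝ E] {a b : E}

theorem isCompact_starPowers (ha : IsOfFinOrder a) : IsCompact (starPowers a) := by
  rw [starPowers, ← image_smul_prod]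
  exact (isCompact_Icc.prod ha.finite_powers.isCompact).image continuous_smul

variable [NormOneClass E]

theorem norm_le_one_of_mem_starPowers (ha : ‖a‖ ≤ 1) (hb : b ∈ starPowers a) : ‖b‖ ≤ 1 := by
  obtain ⟨s, hs, n, rfl⟩ := mem_starPowers.1 hb
  rw [norm_smul, Real.norm_of_nonneg hs.1]
  exact mul_le_one₀ hs.2 (norm_nonneg _)
    ((norm_pow_le a n).trans (pow_le_one₀ (norm_nonneg a) ha))

theorem exists_norm_sub_le_of_mem_starPowers (ha : IsOfFinOrder a) (ha1 : ‖a‖ ≤ 1) {t : ℝ}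
    (ht : t ∈ Ioo (0 : ℝ) 1) (hb : b ∈ starPowers a) :
    ∃ b' ∈ zeroPowers (t • a), ‖b - b'‖ ≤ 1 - t ^ orderOf a := by
  obtain ⟨s, hs, n, rfl⟩ := mem_starPowers.1 hb
  rcases hs.1.eq_or_lt with rfl | hspos
  · refine ⟨0, mem_insert 0 _, ?_⟩
    simpa using pow_le_one₀ ht.1.le ht.2.le
  · obtain ⟨q, hq⟩ := exists_abs_sub_pow_le ⟨hspos, hs.2⟩ ht (Nat.mod_lt n ha.orderOf_pos)
    set m := orderOf a * q + n % orderOf a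
    have hmn : a ^ m = a ^ n := by
      rw [pow_add, pow_mul, pow_orderOf_eq_one, one_pow, one_mul, pow_mod_orderOf]
    refine ⟨(t • a) ^ m, Or.inr ⟨m, rfl⟩, ?_⟩
    calc ‖s • a ^ n - (t • a) ^ m‖ = |s - t ^ m| * ‖a ^ n‖ := by
          rw [smul_pow, hmn, ← sub_smul, norm_smul, Real.norm_eq_abs]
      _ ≤ |s - t ^ m| := mul_le_of_le_one_right (abs_nonneg _)
          ((norm_pow_le a n).trans (pow_le_one₀ (norm_nonneg a) ha1))
      _ ≤ 1 - t ^ orderOf a := hq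

end PowerSets

section ConeSystem

variable {𝕜 X : Type*} [NontriviallyNormedField 𝕜] [NormedAddCommGroup X] [NormedSpace 𝕜 X]
  {z : X} {Q Q' : Set (X →L[𝕜] X)}

/-- The affine map with fixed point `z` and linear part `M`. -/
def affineAbout (z : X) (M : X →L[𝕜] X) (x : X) : X :=
  z + M (x - z)

/-- The maps of `F` followed by the affine maps about `z` with linear parts in `Q`, together with
the constant map `z`. The constant map makes the system nonempty even if `F` is empty. -/
def coneSystem (z : X) (Q : Set (X →L[𝕜] X)) (F : Set (X → X)) : Set (X → X) :=
  insert (fun _ => z) (image2 (fun M φ x => affineAbout z M (φ x)) Q F)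

theorem coneSystem_nonempty (z : X) (Q : Set (X →L[𝕜] X)) (F : Set (X → X)) :
    (coneSystem z Q F).Nonempty :=
  insert_nonempty _ _

theorem dist_affineAbout_le (z : X) (M M' : X →L[𝕜] X) (x y : X) :
    dist (affineAbout z M x) (affineAbout z M' y) ≤ ‖M - M'‖ * dist x z + ‖M'‖ * dist x y := by
  have hsplit : M (x - z) - M' (y - z) = (M - M') (x - z) + M' (x - y) := by
    simp only [map_sub, sub_apply]
    abel
  rw [affineAbout, affineAbout, dist_add_left, dist_eq_norm, dist_eq_norm, dist_eq_norm, hsplit]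
  exact norm_add_le_of_le ((M - M').le_opNorm _) (M'.le_opNorm _)

theorem isContractive_coneSystem {F : Set (X → X)} {K : ℝ≥0} (hF : IsContractive K F) (z : X)
    (hQ : IsCompact Q) (hQ1 : ∀ M ∈ Q, ‖M‖ ≤ 1) : IsContractive K (coneSystem z Q F) where
  lt_one := hF.lt_one
  isCompact := by
    have hcont : Continuous fun q : (X →L[𝕜] X) × (X → X) =>
        fun x => affineAbout z q.1 (q.2 x) := by
      unfold affineAbout
      fun_prop
    rw [coneSystem, ← image_prod]
    exact ((hQ.prod hF.isCompact).image hcont).insert _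
  lipschitzWith := by
    rintro _ (rfl | ⟨M, hM, φ, hφ, rfl⟩)
    · exact LipschitzWith.const' z
    · refine LipschitzWith.of_dist_le_mul fun x y => ?_
      calc dist (affineAbout z M (φ x)) (affineAbout z M (φ y))
          ≤ ‖M - M‖ * dist (φ x) z + ‖M‖ * dist (φ x) (φ y) := dist_affineAbout_le z M M _ _
        _ ≤ dist (φ x) (φ y) := by
            rw [sub_self, norm_zero, zero_mul, zero_add]
            exact mul_le_of_le_one_left dist_nonneg (hQ1 M hM)
        _ ≤ K * dist x y := (hF.lipschitzWith φ hφ).dist_le_mul x y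

theorem hutchinson_coneSystem (z : X) (Q : Set (X →L[𝕜] X)) (F : Set (X → X)) {S : Set X}
    (hS : S.Nonempty) :
    hutchinson (coneSystem z Q F) S = insert z (image2 (affineAbout z) Q (hutchinson F S)) := by
  have himage : hutchinson (image2 (fun M φ x => affineAbout z M (φ x)) Q F) S =
      image2 (affineAbout z) Q (hutchinson F S) := by
    ext y
    simp only [mem_hutchinson, mem_image2]
    grind
  rw [coneSystem, hutchinson_insert, hS.image_const, himage, singleton_union]

theorem hutchinson_insert_affineAbout {F : Set (X → X)} {M : X →L[𝕜] X}
    (hQ : insert 1 ((M * ·) '' Q) = Q) {A : Set X} (hne : A.Nonempty)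
    (hA : hutchinson (coneSystem z Q F) A = A) :
    hutchinson (insert (affineAbout z M) F) A = A := by
  rw [hutchinson_coneSystem z Q F hne] at hA
  set H := hutchinson F A
  have hone : affineAbout z (1 : X →L[𝕜] X) '' H = H :=
    (image_congr fun x _ => add_sub_cancel z x).trans (image_id' H)
  have hmul : affineAbout z M '' image2 (affineAbout z) Q H =
      image2 (affineAbout z) ((M * ·) '' Q) H := by
    simp only [image_image2, image2_image_left, affineAbout, add_sub_cancel_left,
      mul_apply_eq_comp]
  have hz : affineAbout z M z = z := by simp [affineAbout]
  calc hutchinson (insert (affineAbout z M) F) A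
      = affineAbout z M '' A ∪ H := hutchinson_insert _ F A
    _ = affineAbout z M '' insert z (image2 (affineAbout z) Q H) ∪ H := by rw [hA]
    _ = insert z (image2 (affineAbout z) ((M * ·) '' Q) H) ∪ H := by rw [image_insert_eq, hz, hmul]
    _ = insert z (image2 (affineAbout z) (insert 1 ((M * ·) '' Q)) H) := by
        rw [image2_insert_left, hone, insert_union, union_comm H]
    _ = A := by rw [hQ, hA]

theorem hausdorffDist_hutchinson_coneSystem_le {ι : Type*} {f f' : ι → X → X} {S : Set X}
    {ε η R : ℝ} (hε : 0 ≤ ε) (hη : 0 ≤ η) (hR : 0 ≤ R) (hQ1 : ∀ M ∈ Q, ‖M‖ ≤ 1) (hsub : Q' ⊆ Q)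
    (hdense : ∀ M ∈ Q, ∃ M' ∈ Q', ‖M - M'‖ ≤ η) (hf : ∀ i, ∀ x ∈ S, dist (f i x) (f' i x) ≤ ε)
    (hbdd : ∀ i, ∀ x ∈ S, dist (f i x) z ≤ R) :
    Metric.hausdorffDist (hutchinson (coneSystem z Q (range f)) S)
      (hutchinson (coneSystem z Q' (range f')) S) ≤ η * R + ε := by
  have hr : 0 ≤ η * R + ε := by positivity
  have hclose : ∀ M, ∀ M' ∈ Q', ‖M - M'‖ ≤ η → ∀ i, ∀ x ∈ S,
      dist (affineAbout z M (f i x)) (affineAbout z M' (f' i x)) ≤ η * R + ε := by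
    intro M M' hM' hMM' i x hx
    refine (dist_affineAbout_le z M M' _ _).trans (add_le_add ?_ ?_)
    · exact mul_le_mul hMM' (hbdd i x hx) dist_nonneg hη
    · exact (mul_le_of_le_one_left dist_nonneg (hQ1 M' (hsub hM'))).trans (hf i x hx)
  refine hausdorffDist_hutchinson_le hr ?_ ?_
  · rintro _ (rfl | ⟨M, hM, _, ⟨i, rfl⟩, rfl⟩)
    · exact ⟨_, mem_insert _ _, fun x _ => by rwa [dist_self]⟩
    · obtain ⟨M', hM', hMM'⟩ := hdense M hM
      exact ⟨_, Or.inr ⟨M', hM', _, ⟨i, rfl⟩, rfl⟩, hclose M M' hM' hMM' i⟩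
  · rintro _ (rfl | ⟨M', hM', _, ⟨i, rfl⟩, rfl⟩)
    · exact ⟨_, mem_insert _ _, fun x _ => by rwa [dist_self]⟩
    · refine ⟨_, Or.inr ⟨M', hsub hM', _, ⟨i, rfl⟩, rfl⟩, fun x hx => ?_⟩
      rw [dist_comm]
      exact hclose M' M' hM' (by rwa [sub_self, norm_zero]) i x hx

end ConeSystem

section Limit

variable {X : Type*} [NormedAddCommGroup X] [NormedSpace ℝ X] [Nontrivial X]

variable {L : X →L[ℝ] X} {z : X} {K : ℝ≥0} {t : ℝ}

theorem isContractive_coneSystem_zeroPowers {F : Set (X → X)} (hF : IsContractive K F) (z : X)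
    (hL : ‖L‖ ≤ 1) (ht : t ∈ Ico (0 : ℝ) 1) :
    IsContractive K (coneSystem z (zeroPowers (t • L)) F) := by
  have hsmul : ‖t • L‖ < 1 := by
    rw [norm_smul, Real.norm_of_nonneg ht.1]
    exact (mul_le_of_le_one_right ht.1 hL).trans_lt ht.2
  exact isContractive_coneSystem hF z (isCompact_zeroPowers hsmul) fun M hM =>
    norm_le_one_of_mem_starPowers hL
      (zeroPowers_smul_subset_starPowers L (Ico_subset_Icc_self ht) hM)

theorem dist_le_of_hutchinson_coneSystem_eq {ι : Type*} {f f' : ι → X → X}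
    (hf' : IsContractive K (range f')) (hL : IsOfFinOrder L) (hL1 : ‖L‖ ≤ 1)
    (ht : t ∈ Ioo (0 : ℝ) 1) {A A' : NonemptyCompacts X}
    (hA : hutchinson (coneSystem z (starPowers L) (range f)) (A : Set X) = A)
    (hA' : hutchinson (coneSystem z (zeroPowers (t • L)) (range f')) (A' : Set X) = A')
    {ε R : ℝ} (hε : 0 ≤ ε) (hR : 0 ≤ R) (hff' : ∀ i, ∀ x ∈ A, dist (f i x) (f' i x) ≤ ε)
    (hbdd : ∀ i, ∀ x ∈ A, dist (f i x) z ≤ R) :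
    dist A A' ≤ ((1 - t ^ orderOf L) * R + ε) / (1 - K) := by
  have hη : 0 ≤ 1 - t ^ orderOf L := sub_nonneg.2 (pow_le_one₀ ht.1.le ht.2.le)
  have hstep := hausdorffDist_hutchinson_coneSystem_le hε hη hR
    (fun M => norm_le_one_of_mem_starPowers hL1)
    (zeroPowers_smul_subset_starPowers L (Ioo_subset_Icc_self ht))
    (fun M => exists_norm_sub_le_of_mem_starPowers hL hL1 ht) hff' hbdd
  rw [hA] at hstep
  have hK : (0 : ℝ) ≤ 1 - K := sub_nonneg.2 (mod_cast hf'.lt_one.le)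
  have hcone := isContractive_coneSystem_zeroPowers hf' z hL1 (Ioo_subset_Ico_self ht)
  exact (hcone.dist_le_of_hutchinson_eq (coneSystem_nonempty z _ _) A hA').trans
    (div_le_div_of_nonneg_right hstep hK)

theorem tendsto_of_hutchinson_coneSystem_eq {N : ℕ} {f : Fin N → ℝ → X → X}
    (hcont : ∀ (i : Fin N) (x : X), ContinuousOn (fun t => f i t x) (Icc 0 1))
    (hf : ∀ t ∈ Icc (0 : ℝ) 1, IsContractive K (family f t)) (hL : IsOfFinOrder L)
    (hL1 : ‖L‖ ≤ 1) {A₁ : NonemptyCompacts X}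
    (hA₁ : hutchinson (coneSystem z (starPowers L) (family f 1)) (A₁ : Set X) = A₁)
    {A : ℝ → NonemptyCompacts X}
    (hA : ∀ t ∈ Ico (0 : ℝ) 1,
      hutchinson (coneSystem z (zeroPowers (t • L)) (family f t)) (A t : Set X) = A t) :
    Tendsto A (𝓝[<] 1) (𝓝 A₁) := by
  have hone : (1 : ℝ) ∈ Icc (0 : ℝ) 1 := right_mem_Icc.2 zero_le_one
  have hK : (0 : ℝ) < 1 - K := sub_pos.2 (mod_cast (hf 1 hone).lt_one)
  obtain ⟨R, hR, hbdd⟩ : ∃ R : ℝ, 0 < R ∧ ∀ i, ∀ x ∈ A₁, dist (f i 1 x) z ≤ R := by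
    have hcompact :=
      isCompact_hutchinson (hf 1 hone).isCompact (hf 1 hone).lipschitzWith A₁.isCompact
    obtain ⟨R, hR, hsub⟩ := hcompact.isBounded.subset_closedBall_lt 0 z
    exact ⟨R, hR, fun i x hx => hsub (mem_hutchinson.2 ⟨f i 1, mem_range_self i, x, hx, rfl⟩)⟩
  have hunif : ∀ ε > 0, ∀ᶠ t in 𝓝[<] 1, ∀ i, ∀ x ∈ A₁, dist (f i 1 x) (f i t x) ≤ ε := by
    intro ε hε
    refine eventually_all.2 fun i => ?_
    have hi := tendstoUniformlyOn_of_lipschitzWith hone (hcont i)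
      (fun t ht => (hf t ht).lipschitzWith _ (mem_range_self i)) A₁.isCompact
    rw [nhdsWithin_Icc_eq_nhdsLE zero_lt_one] at hi
    filter_upwards [nhdsWithin_mono 1 Iio_subset_Iic_self
      (Metric.tendstoUniformlyOn_iff.1 hi ε hε)] with t ht x hx using (ht x hx).le
  refine Metric.tendsto_nhds.2 fun δ hδ => ?_
  have hbound : Tendsto (fun t : ℝ => ((1 - t ^ orderOf L) * R + (1 - K) * (δ / 2)) / (1 - K))
      (𝓝[<] 1) (𝓝 (δ / 2)) := by
    have hcts : Continuous fun t : ℝ =>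
        ((1 - t ^ orderOf L) * R + (1 - K) * (δ / 2)) / (1 - K) := by fun_prop
    refine (hcts.tendsto' 1 _ ?_).mono_left nhdsWithin_le_nhds
    rw [one_pow, sub_self, zero_mul, zero_add, mul_div_cancel_left₀ _ hK.ne']
  have hε : 0 < (1 - (K : ℝ)) * (δ / 2) := by positivity
  filter_upwards [hunif _ hε, hbound.eventually_lt_const (half_lt_self hδ),
    Ioo_mem_nhdsLT zero_lt_one] with t hclose hlt ht
  rw [dist_comm]
  exact (dist_le_of_hutchinson_coneSystem_eq (hf t (Ioo_subset_Icc_self ht)) hL hL1 ht hA₁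
    (hA t (Ioo_subset_Ico_self ht)) hε.le hR.le hclose hbdd).trans_lt hlt

end Limit

section Isometry

variable {X : Type*} [NormedAddCommGroup X] [NormedSpace ℝ X]

/-- The linear part of a surjective isometry, as a bounded operator. -/
noncomputable def linearPart (g : X ≃ᵢ X) : X →L[ℝ] X :=
  g.toRealLinearIsometryEquiv

theorem norm_linearPart_le (g : X ≃ᵢ X) : ‖linearPart g‖ ≤ 1 :=
  g.toRealLinearIsometryEquiv.toLinearIsometry.norm_toContinuousLinearMap_le

theorem HasPeriodicLinearPart.isOfFinOrder {g : X ≃ᵢ X} (hg : HasPeriodicLinearPart g) :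
    IsOfFinOrder (linearPart g) := by
  obtain ⟨p, hp, hperiod⟩ := hg
  refine isOfFinOrder_iff_pow_eq_one.2 ⟨p, hp, ContinuousLinearMap.ext fun x => ?_⟩
  rw [FunLike.coe_pow_eq_iterate]
  exact hperiod x

theorem scaled_eq_affineAbout (g : X ≃ᵢ X) (t : ℝ) :
    scaled g t = affineAbout (g.symm 0) (t • linearPart g) := by
  ext x
  have hlinear : linearPart g (x - g.symm 0) = g x := by
    simp [linearPart, map_sub, g.toRealLinearIsometryEquiv_apply]
  rw [affineAbout, smul_apply, hlinear, scaled, add_comm]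

theorem dist_scaled (g : X ≃ᵢ X) {t : ℝ} (ht : 0 ≤ t) (x y : X) :
    dist (scaled g t x) (scaled g t y) = t * dist x y := by
  rw [scaled, scaled, dist_add_right, dist_smul₀, g.dist_eq, Real.norm_of_nonneg ht]

theorem lipschitzWith_scaled (g : X ≃ᵢ X) (t : ℝ≥0) : LipschitzWith t (scaled g t) :=
  LipschitzWith.of_dist_le_mul fun x y => (dist_scaled g t.coe_nonneg x y).le

theorem antilipschitzWith_scaled (g : X ≃ᵢ X) {t : ℝ≥0} (ht : t ≠ 0) :
    AntilipschitzWith t⁻¹ (scaled g t) := by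
  refine AntilipschitzWith.of_le_mul_dist fun x y => ?_
  rw [dist_scaled g t.coe_nonneg, NNReal.coe_inv, inv_mul_cancel_left₀ (NNReal.coe_ne_zero.2 ht)]

theorem extendedFamily_eq_insert {N : ℕ} (f : Fin N → ℝ → X → X) (g : X ≃ᵢ X) (t : ℝ) :
    extendedFamily f g t = insert (scaled g t) (family f t) :=
  union_singleton

theorem hutchinson_extendedFamily_eq {N : ℕ} {f : Fin N → ℝ → X → X} {g : X ≃ᵢ X} {t : ℝ}
    {Q : Set (X →L[ℝ] X)} (hQ : insert 1 ((t • linearPart g * ·) '' Q) = Q)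
    {A : NonemptyCompacts X}
    (hA : hutchinson (coneSystem (g.symm 0) Q (family f t)) (A : Set X) = A) :
    hutchinson (extendedFamily f g t) (A : Set X) = A := by
  rw [extendedFamily_eq_insert, scaled_eq_affineAbout]
  exact hutchinson_insert_affineAbout hQ A.nonempty hA

theorem IsContractive.isAttractor_extendedFamily_iff_eq [CompleteSpace X] {N : ℕ}
    {f : Fin N → ℝ → X → X} {K : ℝ≥0} {t : ℝ} (hf : IsContractive K (family f t))
    (ht : t ∈ Ico (0 : ℝ) 1) (g : X ≃ᵢ X) {A : NonemptyCompacts X}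
    (hA : hutchinson (extendedFamily f g t) (A : Set X) = A) (B : NonemptyCompacts X) :
    IsAttractor (extendedFamily f g t) B ↔ B = A := by
  lift t to ℝ≥0 using ht.1
  rw [extendedFamily_eq_insert] at hA ⊢
  exact (hf.insert (mod_cast ht.2) (lipschitzWith_scaled g t)).isAttractor_iff_eq
    (insert_nonempty _ _) hA B

theorem not_isAttractor_extendedFamily [Nontrivial X] {N : ℕ} (f : Fin N → ℝ → X → X)
    (g : X ≃ᵢ X) {t : ℝ} (ht : 1 < t) (A : NonemptyCompacts X) :
    ¬IsAttractor (extendedFamily f g t) A := by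
  have : PerfectSpace X := perfectSpace_of_module ℝ X
  lift t to ℝ≥0 using zero_le_one.trans ht.le
  have ht' : 1 < t := mod_cast ht
  exact not_isAttractor_of_antilipschitzWith (Or.inr rfl)
    (antilipschitzWith_scaled g (zero_lt_one.trans ht').ne') (inv_lt_one_of_one_lt₀ ht') A

end Isometry

end IFS

theorem mainTheorem1 {X : Type*} [NormedAddCommGroup X] [NormedSpace ℝ X] [CompleteSpace X]
    [Nontrivial X] (g : X ≃ᵢ X) (hg : IFS.HasPeriodicLinearPart g)
    {N : ℕ} (f : Fin N → ℝ → X → X)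
    (hcont : ∀ (i : Fin N) (x : X), ContinuousOn (fun t : ℝ => f i t x) (Set.Icc 0 1))
    (hlip : (⨆ t ∈ Set.Icc (0 : ℝ) 1, IFS.lipSystem (IFS.family f t)) < 1) :
    IFS.IsThreshold (IFS.extendedFamily f g) 1 ∧
    (∃! A : TopologicalSpace.NonemptyCompacts X,
      IFS.IsUpperTransitionAttractor (IFS.extendedFamily f g) A) ∧
    ∃ (A : ℝ → TopologicalSpace.NonemptyCompacts X)
      (Aupper : TopologicalSpace.NonemptyCompacts X),
      (∀ t ∈ Set.Ico (0 : ℝ) 1, ∀ B : TopologicalSpace.NonemptyCompacts X,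
        IFS.IsAttractor (IFS.extendedFamily f g t) B ↔ B = A t) ∧
      Filter.Tendsto A (nhdsWithin 1 (Set.Iio 1)) (nhds Aupper) ∧
      IFS.hutchinson (IFS.extendedFamily f g 1) (Aupper : Set X) = Aupper ∧
      IFS.IsUpperTransitionAttractor (IFS.extendedFamily f g) Aupper := by
  obtain ⟨K, hK⟩ := IFS.exists_forall_isContractive_family hlip
  have hL := hg.isOfFinOrder
  have hL1 := IFS.norm_linearPart_le g
  obtain ⟨A₁, hA₁⟩ := (IFS.isContractive_coneSystem (hK 1 (right_mem_Icc.2 zero_le_one)) (g.symm 0)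
    (IFS.isCompact_starPowers hL) fun M => IFS.norm_le_one_of_mem_starPowers hL1)
      |>.exists_hutchinson_eq (IFS.coneSystem_nonempty _ _ _)
  have hexists : ∀ t ∈ Ico (0 : ℝ) 1, ∃ A : NonemptyCompacts X, IFS.hutchinson (IFS.coneSystem
      (g.symm 0) (IFS.zeroPowers (t • IFS.linearPart g)) (IFS.family f t)) (A : Set X) = A :=
    fun t ht => (IFS.isContractive_coneSystem_zeroPowers (hK t (Ico_subset_Icc_self ht)) _ hL1 ht)
      |>.exists_hutchinson_eq (IFS.coneSystem_nonempty _ _ _)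
  choose! A hA using hexists
  have hattractor : ∀ t ∈ Ico (0 : ℝ) 1, ∀ B,
      IFS.IsAttractor (IFS.extendedFamily f g t) B ↔ B = A t := fun t ht =>
    (hK t (Ico_subset_Icc_self ht)).isAttractor_extendedFamily_iff_eq ht g
      (IFS.hutchinson_extendedFamily_eq (IFS.insert_one_image_mul_zeroPowers _) (hA t ht))
  have hinvariant : IFS.hutchinson (IFS.extendedFamily f g 1) (A₁ : Set X) = A₁ :=
    IFS.hutchinson_extendedFamily_eq
      ((one_smul ℝ (IFS.linearPart g)).symm ▸ IFS.insert_one_image_mul_starPowers hL) hA₁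
  have hlim := IFS.tendsto_of_hutchinson_coneSystem_eq hcont hK hL hL1 hA₁ hA
  have hupper := IFS.isUpperTransitionAttractor_iff_eq hattractor hlim
  exact ⟨⟨fun t h0 h1 => ⟨A t, (hattractor t ⟨h0, h1⟩ _).2 rfl⟩,
    fun t _ h1 ⟨B, hB⟩ => IFS.not_isAttractor_extendedFamily f g h1 B hB⟩,
    ⟨A₁, (hupper A₁).2 rfl, fun C => (hupper C).1⟩,
    A, A₁, hattractor, hlim, hinvariant, (hupper A₁).2 rfl⟩
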